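/- Let $s,v,m$ be positive integers and $\epsilon=\pm1$, with $vm^2>4$ if $\epsilon=-1$. Put \[ d=\frac{svm}{2},\qquad k=\frac{s^2v(vm^2+4\epsilon)}{4},\qquad \xi=d+\sqrt{k}, \] so that $\xi$ is a real quadratic irrational satisfying $\xi^2-t\xi-u=0$ with $t=svm$, $u=\epsilon s^2v$. Let $f_\xi(x)=2d+\dfrac{k-d^2}{x}$ be regarded as a map of $\mathbb{R}\cup\{\infty\}$ to itself. Call a fraction $p/q$ ($p,q\in\mathbb{Z}$) Pellian for $\xi$ if $q>0$, $p/q>t/2$ and $p^2-tpq-uq^2=\pm1$. Define $F_0=0$, $F_1=1$, $F_{n+1}=F_n+F_{n-1}$ and $G_0=0$, $G_1=1$, $G_{n+1}=2G_n+G_{n-1}$. Call $\xi$ exceptional if one of the following holds: (1) $\xi=r\cdot\frac{3+\sqrt5}{2}$ or $\xi=r\cdot\frac{5+\sqrt5}{2}$, where $r$ is a positive integer dividing $F_{2n+1}$ for some $n\ge0$; (2) $\xi=r(2+\sqrt2)$, where $r$ is a positive integer dividing $G_{2n+1}$ for some $n\ge0$. If $\xi$ is not exceptional, then the orbit $\{f_\xi^n(\infty)\}_{n\ge1}$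 contains every fraction that is Pellian for $\xi$ (in particular, every Pellian convergent of $\xi$). If $\xi$ is exceptional, then there is a fraction that is Pellian for $\xi$ and is a convergent of the simple continued fraction of $\xi$, but is not in this orbit. -/

import Mathlib

/-- The linear fractional transformation `x ↦ 2d + (k - d²)/x` of the real projective line
`ℝ ∪ {∞}`, which fixes `d ± √k`. It is the conjugate of `x ↦ (dx + k)/(x + d)` by the
translation by `d`. -/
noncomputable def lftXi (d k : ℝ) : OnePoint ℝ → OnePoint ℝ
  | none => ((2 * d : ℝ) : OnePoint ℝ)
  | some x =>
      open Classical in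
      if x = 0 then OnePoint.infty else ((2 * d + (k - d ^ 2) / x : ℝ) : OnePoint ℝ)

/-- The forward orbit `{f(∞), f(f(∞)), …}` of `∞`. -/
def orbitInfty (f : OnePoint ℝ → OnePoint ℝ) : Set (OnePoint ℝ) :=
  {y | ∃ n : ℕ, 1 ≤ n ∧ f^[n] OnePoint.infty = y}

/-- `p / q` is Pellian for the quadratic integer `ξ`, a root of `x² - tx - u` that exceeds the
absolute value of its conjugate `t - ξ`. -/
def IsPellian (ξ : ℝ) (p q : ℤ) : Prop :=
  ∃ t u : ℤ, ξ ^ 2 - t * ξ - u = 0 ∧ |(t : ℝ) - ξ| < ξ ∧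
    0 < q ∧ (t : ℝ) / 2 < (p : ℝ) / q ∧
    (p ^ 2 - t * p * q - u * q ^ 2 = 1 ∨ p ^ 2 - t * p * q - u * q ^ 2 = -1)

/-- `p / q` is a convergent of the simple continued fraction of `ξ`. -/
def IsConvergent (ξ : ℝ) (p q : ℤ) : Prop :=
  ∃ n : ℕ, ((p : ℚ) / q) = ξ.convergent n

/-- Pell numbers: `0, 1, 2, 5, 12, 29, …`. -/
def pellNumber : ℕ → ℕ
  | 0 => 0
  | 1 => 1
  | n + 2 => 2 * pellNumber (n + 1) + pellNumber n

/-- The exceptional values of `ξ`. -/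
def IsExceptional (ξ : ℝ) : Prop :=
  (∃ s n : ℕ, s ∣ Nat.fib (2 * n + 1) ∧
    (ξ = s * ((3 + √5) / 2) ∨ ξ = s * ((5 + √5) / 2))) ∨
  (∃ s n : ℕ, s ∣ pellNumber (2 * n + 1) ∧ ξ = s * (2 + √2))

/-!
Write `t = svm`, `u = εs²v` and `b = sq`, so that Pellian fractions correspond to solutions of
`p² - vmpb - εvb² = ν` with `ν = ±1`, and put `p' = ε(p - vmb)`, `b' = ε(b - mp')`. The map `f_ξ`
sends `sp'/b'` to `svb/p'` and that to `sp/b`, while `pp' = vb² + εν` and `vbb' = p'² - ν`.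
If `ε = 1` or `ν = 1`, these two products show that `(p', b')` is a smaller solution unless
`p'b' = 0`, and then `p/q` is `f_ξ(∞)` or `f_ξ(f_ξ(∞))`. If `ε = -1` and `ν = -1`, the equation
reads `p² + vb² + 1 = vmpb`, and Vieta jumping leaves only `(v, m) = (1, 3), (2, 2), (5, 1)`; there
the values of `b` are the Fibonacci or Pell numbers of odd index, so that a solution with `s ∣ b`
exists exactly when `ξ` is exceptional. Such a solution is a convergent by Legendre's theorem, and
it is outside the orbit, on which `x² - tx - u` is positive when `u < 0`.
-/

/-- The integers `p`, `q` solve `p² - tpq - uq² = ν`, with `q > 0` and `p / q > t / 2`. For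
`ν = ±1` this is the Pellian condition without `ξ`, in which `q` may absorb a factor of `t`. -/
structure IsPellSolution (t u ν p q : ℤ) : Prop where
  den_pos : 0 < q
  lt_two_mul_num : t * q < 2 * p
  norm_eq : p ^ 2 - t * p * q - u * q ^ 2 = ν

theorem isPellSolution_mul_iff {s t u ν p q : ℤ} (hs : 0 < s) :
    IsPellSolution (s * t) (s ^ 2 * u) ν p q ↔ IsPellSolution t u ν p (s * q) := by
  constructor
  · rintro ⟨hq, hlt, h⟩
    exact ⟨mul_pos hs hq, by linarith, by linear_combination h⟩
  · rintro ⟨hq, hlt, h⟩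
    exact ⟨pos_of_mul_pos_right hq hs.le, by linarith, by linear_combination h⟩

theorem IsPellSolution.num_pos {t u ν p q : ℤ} (h : IsPellSolution t u ν p q) (ht : 0 ≤ t) :
    0 < p := by
  linarith [mul_nonneg ht h.den_pos.le, h.lt_two_mul_num]

/-! ### Orbits of `∞` -/

theorem map_infty_mem_orbitInfty (f : OnePoint ℝ → OnePoint ℝ) :
    f OnePoint.infty ∈ orbitInfty f :=
  ⟨1, le_rfl, rfl⟩

theorem map_mem_orbitInfty {f : OnePoint ℝ → OnePoint ℝ} {y : OnePoint ℝ}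
    (hy : y ∈ orbitInfty f) : f y ∈ orbitInfty f := by
  obtain ⟨n, hn, rfl⟩ := hy
  exact ⟨n + 1, by omega, Function.iterate_succ_apply' f n _⟩

theorem orbitInfty_subset {f : OnePoint ℝ → OnePoint ℝ} {S : Set (OnePoint ℝ)}
    (hinfty : OnePoint.infty ∈ S) (hS : Set.MapsTo f S S) : orbitInfty f ⊆ S := by
  rintro _ ⟨n, -, rfl⟩
  exact hS.iterate n hinfty

theorem lftXi_infty (d k : ℝ) : lftXi d k OnePoint.infty = ((2 * d : ℝ) : OnePoint ℝ) := rfl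

theorem lftXi_zero (d k : ℝ) : lftXi d k ((0 : ℝ) : OnePoint ℝ) = OnePoint.infty :=
  if_pos rfl

theorem lftXi_coe (d k : ℝ) {x : ℝ} (hx : x ≠ 0) :
    lftXi d k (x : OnePoint ℝ) = ((2 * d + (k - d ^ 2) / x : ℝ) : OnePoint ℝ) :=
  if_neg hx

theorem quadratic_pos_of_mem_orbitInfty {d k x : ℝ} (hk : k < d ^ 2)
    (hx : (x : OnePoint ℝ) ∈ orbitInfty (lftXi d k)) :
    0 < x ^ 2 - 2 * d * x - (k - d ^ 2) := by
  suffices h : orbitInfty (lftXi d k) ⊆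
      {z | ∀ y : ℝ, z = y → 0 < y ^ 2 - 2 * d * y - (k - d ^ 2)} from h hx x rfl
  refine orbitInfty_subset (fun y hy => absurd hy.symm (OnePoint.coe_ne_infty y)) ?_
  intro z hz y hy
  induction z with
  | infty =>
    rw [lftXi_infty, OnePoint.coe_eq_coe] at hy
    subst hy
    linarith
  | coe x =>
    rcases eq_or_ne x 0 with rfl | hx
    · rw [lftXi_zero] at hy
      exact absurd hy.symm (OnePoint.coe_ne_infty y)
    · rw [lftXi_coe d k hx, OnePoint.coe_eq_coe] at hy
      have hnorm : y ^ 2 - 2 * d * y - (k - d ^ 2) =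
          (d ^ 2 - k) * (x ^ 2 - 2 * d * x - (k - d ^ 2)) / x ^ 2 := by
        rw [← hy]
        field_simp
        ring
      rw [hnorm]
      exact div_pos (mul_pos (sub_pos.2 hk) (hz x rfl)) (by positivity)

theorem IsPellSolution.notMem_orbitInfty {t u ν p q : ℤ} {d k : ℝ} (hν : ν ≤ 0) (hu : u < 0)
    (hd : 2 * d = t) (hk : k - d ^ 2 = u) (h : IsPellSolution t u ν p q) :
    ((p / q : ℝ) : OnePoint ℝ) ∉ orbitInfty (lftXi d k) := by
  intro hmem
  have huR : (u : ℝ) < 0 := by exact_mod_cast hu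
  have hqR : (0 : ℝ) < q := by exact_mod_cast h.den_pos
  have hνR : (ν : ℝ) ≤ 0 := by exact_mod_cast hν
  have hnorm : (p : ℝ) ^ 2 - t * p * q - u * q ^ 2 = ν := by exact_mod_cast h.norm_eq
  have hpos := quadratic_pos_of_mem_orbitInfty (by linarith) hmem
  have heq : ((p / q : ℝ)) ^ 2 - 2 * d * (p / q) - (k - d ^ 2) = ν / q ^ 2 := by
    rw [hd, hk, ← hnorm]
    field_simp
  rw [heq] at hpos
  exact hpos.not_ge (div_nonpos_of_nonpos_of_nonneg hνR (sq_nonneg _))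

/-! ### Descent along the orbit -/

section Descent

variable {v m ε ν p b : ℤ}

theorem exists_conj_of_norm_eq (hε : ε = 1 ∨ ε = -1)
    (hnorm : p ^ 2 - v * m * p * b - ε * v * b ^ 2 = ν) :
    ∃ p' b' : ℤ, p = v * m * b + ε * p' ∧ b = m * p' + ε * b' ∧ p * p' = v * b ^ 2 + ε * ν ∧
      v * b * b' = p' ^ 2 - ν ∧ p' ^ 2 - v * m * p' * b' - ε * v * b' ^ 2 = ν := by
  have hε2 : ε ^ 2 = 1 := by rcases hε with rfl | rfl <;> rfl
  obtain ⟨p', hp'⟩ : ∃ p', p' = ε * (p - v * m * b) := ⟨_, rfl⟩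
  obtain ⟨b', hb'⟩ : ∃ b', b' = ε * (b - m * p') := ⟨_, rfl⟩
  have hpeq : p = v * m * b + ε * p' := by
    rw [hp']
    linear_combination (-(p - v * m * b)) * hε2
  have hbeq : b = m * p' + ε * b' := by
    rw [hb']
    linear_combination (-(b - m * p')) * hε2
  have hpp' : p * p' = v * b ^ 2 + ε * ν := by
    rw [hp']
    linear_combination ε * hnorm + v * b ^ 2 * hε2
  have hbb' : v * b * b' = p' ^ 2 - ν := by
    rw [hb']
    linear_combination -ε * hpp' + ε * p' * hpeq + (p' ^ 2 - ν) * hε2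
  exact ⟨p', b', hpeq, hbeq, hpp', hbb', by linear_combination v * b' * hbeq - hbb'⟩

theorem IsPellSolution.exists_descent (hv : 0 < v) (hm : 0 < m) (hε : ε = 1 ∨ ε = -1)
    (hν : ν = 1 ∨ ν = -1) (hεν : ε = 1 ∨ ν = 1) (h : IsPellSolution (v * m) (ε * v) ν p b) :
    ∃ p' b' : ℤ, p = v * m * b + ε * p' ∧ b = m * p' + ε * b' ∧
      (p' = 0 ∨ 0 < p' ∧ (b' = 0 ∨ b' < b ∧ IsPellSolution (v * m) (ε * v) ν p' b')) := by
  have hp0 := h.num_pos (mul_pos hv hm).le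
  obtain ⟨hb, hlt, hnorm⟩ := h
  obtain ⟨p', b', hpeq, hbeq, hpp', hbb', hnorm'⟩ := exists_conj_of_norm_eq hε hnorm
  have hp'0 : 0 ≤ p' := by
    have hεν1 : -1 ≤ ε * ν := by rcases hε with rfl | rfl <;> rcases hν with rfl | rfl <;> decide
    exact (mul_nonneg_iff_of_pos_left hp0).1 (by nlinarith)
  refine ⟨p', b', hpeq, hbeq, hp'0.eq_or_lt.imp Eq.symm fun hp'pos => ⟨hp'pos, ?_⟩⟩
  have hvb : 0 < v * b := mul_pos hv hb
  have hb'0 : 0 ≤ b' :=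
    (mul_nonneg_iff_of_pos_left hvb).1 (by rcases hν with rfl | rfl <;> nlinarith)
  refine hb'0.eq_or_lt.imp Eq.symm fun hb'pos => ?_
  have hp'p : p' < p := by
    rcases hε with rfl | rfl <;> linarith [mul_pos (mul_pos hv hm) hb]
  have hb'b : b' < b := by
    have hνε : 0 ≤ ν * (1 - ε) := by
      rcases hεν with rfl | rfl
      · simp
      · rcases hε with rfl | rfl <;> decide
    have hdiff : v * b * (b - b') = p' * (p - p') + ν * (1 - ε) := by
      linear_combination -hbb' - hpp'
    refine sub_pos.1 (pos_of_mul_pos_right (hdiff ▸ ?_) hvb.le)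
    linarith [mul_pos hp'pos (sub_pos.2 hp'p)]
  have hlt' : v * m * b' < 2 * p' := by
    have hsq : 0 < p' ^ 2 + ν + ε * (v * b' ^ 2) := by
      have hνb : -1 ≤ ν := by rcases hν with rfl | rfl <;> decide
      rcases hεν with rfl | rfl
      · nlinarith
      · rcases hε with rfl | rfl <;> nlinarith
    refine sub_pos.1 (pos_of_mul_pos_right (a := p') ?_ hp'pos.le)
    linarith
  exact ⟨hb'b, hb'pos, hlt', hnorm'⟩

theorem IsPellSolution.mem_orbitInfty {s d k : ℝ} (hs : s ≠ 0) (hv : 0 < v) (hm : 0 < m)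
    (hε : ε = 1 ∨ ε = -1) (hν : ν = 1 ∨ ν = -1) (hεν : ε = 1 ∨ ν = 1)
    (hd : 2 * d = s * (v * m)) (hk : k - d ^ 2 = s ^ 2 * (ε * v))
    (h : IsPellSolution (v * m) (ε * v) ν p b) :
    ((s * p / b : ℝ) : OnePoint ℝ) ∈ orbitInfty (lftXi d k) := by
  have hv0 : (v : ℝ) ≠ 0 := by exact_mod_cast hv.ne'
  induction hN : b.toNat using Nat.strong_induction_on generalizing p b with
  | _ N ih =>
    have hb0 : (b : ℝ) ≠ 0 := by exact_mod_cast h.den_pos.ne'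
    obtain ⟨p', b', hp, hb, hcases⟩ := h.exists_descent hv hm hε hν hεν
    have hpR : (p : ℝ) = v * m * b + ε * p' := by exact_mod_cast hp
    have hbR : (b : ℝ) = m * p' + ε * b' := by exact_mod_cast hb
    have hinfty := map_infty_mem_orbitInfty (lftXi d k)
    rw [lftXi_infty, hd] at hinfty
    rcases hcases with rfl | ⟨hp'pos, hcases⟩
    · have heq : s * p / b = s * (v * m) := by
        rw [hpR]
        field_simp
        simp
      rwa [heq]
    have hp'0 : (p' : ℝ) ≠ 0 := by exact_mod_cast hp'pos.ne'
    have hmid : ((s * v * b / p' : ℝ) : OnePoint ℝ) ∈ orbitInfty (lftXi d k) := by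
      rcases hcases with rfl | ⟨hlt, h'⟩
      · have heq : s * v * b / p' = s * (v * m) := by
          rw [hbR]
          field_simp
          simp
        rwa [heq]
      · have hb'0 : (b' : ℝ) ≠ 0 := by exact_mod_cast h'.den_pos.ne'
        have hmap := map_mem_orbitInfty (ih _ (by have := h'.den_pos; omega) h' rfl)
        rw [lftXi_coe d k (by positivity), hd, hk] at hmap
        convert hmap using 2
        rw [hbR]
        field_simp
    have hmap := map_mem_orbitInfty hmid
    rw [lftXi_coe d k (by positivity), hd, hk] at hmap
    convert hmap using 2
    rw [hpR]
    field_simp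

end Descent

/-! ### Vieta jumping for solutions of norm `-1` -/

section Vieta

variable {v m p b : ℤ}

theorem eq_of_vieta_equation_of_minimal (hv : 0 < v) (hp : 0 < p) (hb : 0 < b)
    (h : p ^ 2 + v * b ^ 2 + 1 = v * m * p * b) (hpb : p ^ 2 ≤ v * b ^ 2 + 1)
    (hbp : v * b ^ 2 ≤ p ^ 2 + 1) :
    v = 1 ∧ m = 3 ∨ v = 2 ∧ m = 2 ∨ v = 5 ∧ m = 1 := by
  have hgap : v * b ^ 2 = p ^ 2 - 1 ∨ v * b ^ 2 = p ^ 2 ∨ v * b ^ 2 = p ^ 2 + 1 := by omega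
  have hp2 : p ≤ 2 := by
    rcases hgap with hgap | hgap | hgap
    · have hmb : v * m * b = 2 * p :=
        mul_left_cancel₀ hp.ne' (by linear_combination hgap - h)
      have hdvd : (p ^ 2 - 1) ∣ 4 :=
        ⟨v * m ^ 2 - 4, by
          linear_combination v * m ^ 2 * hgap - (v * m * b + 2 * p) * hmb⟩
      have := Int.le_of_dvd four_pos hdvd
      nlinarith
    · have hdvd : p ∣ 1 := ⟨v * m * b - 2 * p, by linear_combination h - hgap⟩
      linarith [Int.le_of_dvd one_pos hdvd]
    · have hdvd : p ∣ 2 := ⟨v * m * b - 2 * p, by linear_combination h - hgap⟩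
      exact Int.le_of_dvd two_pos hdvd
  have hb2 : b ≤ 2 := by nlinarith
  have hv5 : v ≤ 5 := by nlinarith
  interval_cases p <;> interval_cases b <;> interval_cases v <;> omega

theorem eq_of_vieta_equation (hv : 0 < v) (hp : 0 < p) (hb : 0 < b)
    (h : p ^ 2 + v * b ^ 2 + 1 = v * m * p * b) :
    v = 1 ∧ m = 3 ∨ v = 2 ∧ m = 2 ∨ v = 5 ∧ m = 1 := by
  induction hN : (p + b).toNat using Nat.strong_induction_on generalizing p b with
  | _ N ih =>
    obtain ⟨p', hp'⟩ : ∃ p', p' = v * m * b - p := ⟨_, rfl⟩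
    obtain ⟨b', hb'⟩ : ∃ b', b' = m * p - b := ⟨_, rfl⟩
    have hpp' : p * p' = v * b ^ 2 + 1 := by rw [hp']; linear_combination -h
    have hbb' : v * b * b' = p ^ 2 + 1 := by rw [hb']; linear_combination -h
    have hvb : 0 < v * b := mul_pos hv hb
    have hp'pos : 0 < p' := pos_of_mul_pos_right (hpp' ▸ by positivity) hp.le
    have hb'pos : 0 < b' := pos_of_mul_pos_right (hbb' ▸ by positivity) hvb.le
    rcases lt_or_ge p' p with hlt | hple
    · exact ih _ (by omega) hp'pos hb (by rw [hp']; linear_combination h) rfl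
    rcases lt_or_ge b' b with hlt | hble
    · exact ih _ (by omega) hp hb'pos (by rw [hb']; linear_combination h) rfl
    exact eq_of_vieta_equation_of_minimal hv hp hb h (by nlinarith) (by nlinarith)

end Vieta

/-! ### Lucas sequences and the equation `x² + cxy - y² = ±1` -/

/-- `U` is the Lucas sequence of the first kind `Uₙ(c, -1)`; `c = 1` gives the Fibonacci numbers
and `c = 2` the Pell numbers. -/
structure IsLucasSeq (c : ℕ) (U : ℕ → ℕ) : Prop where
  zero : U 0 = 0
  one : U 1 = 1
  add_two : ∀ n, U (n + 2) = c * U (n + 1) + U n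

theorem isLucasSeq_fib : IsLucasSeq 1 Nat.fib :=
  ⟨rfl, rfl, fun n => by rw [Nat.fib_add_two, one_mul, add_comm]⟩

theorem isLucasSeq_pellNumber : IsLucasSeq 2 pellNumber :=
  ⟨rfl, rfl, fun _ => rfl⟩

namespace IsLucasSeq

variable {c : ℕ} {U : ℕ → ℕ}

theorem cassini (hU : IsLucasSeq c U) (n : ℕ) :
    (U n : ℤ) ^ 2 + c * U n * U (n + 1) - (U (n + 1) : ℤ) ^ 2 = -(-1) ^ n := by
  induction n with
  | zero => simp [hU.zero, hU.one]
  | succ n ih =>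
    rw [hU.add_two]
    push_cast
    linear_combination -ih

theorem exists_eq_of_cassini (hU : IsLucasSeq c U) (hc : 0 < c) {x y : ℤ} (hx : 0 ≤ x)
    (hy : 0 < y) (h : x ^ 2 + c * x * y - y ^ 2 = 1 ∨ x ^ 2 + c * x * y - y ^ 2 = -1) :
    ∃ n, x = U n ∧ y = U (n + 1) := by
  have hcZ : (0 : ℤ) < c := by exact_mod_cast hc
  induction hN : (x + y).toNat using Nat.strong_induction_on generalizing x y with
  | _ N ih =>
    rcases hx.eq_or_lt with rfl | hx
    · have hy1 : y = 1 := by rcases h with h | h <;> nlinarith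
      exact ⟨0, by simp [hU.zero], by simp [hU.one, hy1]⟩
    · have hcx : 0 < c * x := mul_pos hcZ hx
      have hle : c * x ≤ y := by
        by_contra hlt
        rcases h with h | h <;> nlinarith
      obtain ⟨n, hn, hn'⟩ := ih _ (by omega) (sub_nonneg.2 hle) hx
        (h.symm.imp (fun h => by linear_combination -h) (fun h => by linear_combination -h)) rfl
      refine ⟨n + 1, hn', ?_⟩
      rw [hU.add_two]
      push_cast
      rw [← hn', ← hn]
      ring

theorem exists_eq_odd_index (hU : IsLucasSeq c U) (hc : 0 < c) {x y : ℤ} (hy : 0 < y)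
    (hxy : 0 < 2 * x + c * y) (h : x ^ 2 + c * x * y - y ^ 2 = -1) :
    ∃ n, y = U (2 * n + 1) := by
  have hx : 0 ≤ x := by
    by_contra hneg
    have : 0 ≤ x * (x + c * y) := by nlinarith
    nlinarith
  obtain ⟨n, rfl, rfl⟩ := hU.exists_eq_of_cassini hc hx hy (Or.inr h)
  have heven : Even n := by
    rw [hU.cassini] at h
    exact neg_one_pow_eq_one_iff_even (by decide) |>.1 (neg_injective h)
  obtain ⟨l, rfl⟩ := heven
  exact ⟨l, by rw [two_mul]⟩

theorem odd_index_pos (hU : IsLucasSeq c U) (n : ℕ) : 0 < U (2 * n + 1) := by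
  induction n with
  | zero => simp [hU.one]
  | succ n ih =>
    rw [mul_add_one, add_right_comm, hU.add_two]
    omega

-- The substitution `p = x + jy` turns `x² + cxy - y²` into `p² - (2j - c)py - (1 + jc - j²)y²`.
theorem isPellSolution (hU : IsLucasSeq c U) (hc : 0 < c) {j : ℤ} (n : ℕ) :
    IsPellSolution (2 * j - c) (1 + j * c - j ^ 2) (-1) (U (2 * n) + j * U (2 * n + 1))
      (U (2 * n + 1)) where
  den_pos := by exact_mod_cast hU.odd_index_pos n
  lt_two_mul_num := by
    have : (0 : ℤ) < c * U (2 * n + 1) := by exact_mod_cast mul_pos hc (hU.odd_index_pos n)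
    linarith [(U (2 * n)).cast_nonneg (α := ℤ)]
  norm_eq := by
    have h := hU.cassini (2 * n)
    rw [(even_two_mul n).neg_one_pow] at h
    linear_combination h

theorem exists_eq_of_isPellSolution (hU : IsLucasSeq c U) (hc : 0 < c) {j p y : ℤ}
    (h : IsPellSolution (2 * j - c) (1 + j * c - j ^ 2) (-1) p y) :
    ∃ n, y = U (2 * n + 1) :=
  hU.exists_eq_odd_index hc (x := p - j * y) h.den_pos (by linarith [h.lt_two_mul_num])
    (by linear_combination h.norm_eq)

theorem exists_isPellSolution_of_dvd (hU : IsLucasSeq c U) (hc : 0 < c) {r n : ℕ} (j : ℤ)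
    (hr : r ∣ U (2 * n + 1)) :
    ∃ p q, IsPellSolution (r * (2 * j - c)) (r ^ 2 * (1 + j * c - j ^ 2)) (-1) p q := by
  have hr0 : (0 : ℤ) < r := by exact_mod_cast Nat.pos_of_dvd_of_pos hr (hU.odd_index_pos n)
  obtain ⟨q, hq⟩ := hr
  have h := hU.isPellSolution hc (j := j) n
  rw [hq, Nat.cast_mul] at h
  exact ⟨_, q, (isPellSolution_mul_iff hr0).2 h⟩

theorem exists_dvd_of_isPellSolution (hU : IsLucasSeq c U) (hc : 0 < c) {s : ℕ} {j p q : ℤ}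
    (h : IsPellSolution (2 * j - c) (1 + j * c - j ^ 2) (-1) p (s * q)) :
    ∃ n, s ∣ U (2 * n + 1) := by
  obtain ⟨n, hn⟩ := hU.exists_eq_of_isPellSolution hc h
  exact ⟨n, Int.natCast_dvd_natCast.1 ⟨q, hn.symm⟩⟩

end IsLucasSeq

/-! ### Quadratic integers -/

/-- `ξ` is the larger of two distinct real roots of `x² - tx - u`; as the roots add up to `t`,
this means `t < 2ξ`. -/
structure IsLargerRoot (ξ : ℝ) (t u : ℤ) : Prop where
  root : ξ ^ 2 - t * ξ - u = 0
  lt_two_mul : t < 2 * ξ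

theorem isLargerRoot_add_sqrt {t u : ℤ} {d k : ℝ} (hk0 : 0 < k) (hd : 2 * d = t)
    (hk : k - d ^ 2 = u) : IsLargerRoot (d + √k) t u where
  root := by
    rw [← hd, ← hk]
    linear_combination Real.sq_sqrt hk0.le
  lt_two_mul := by
    rw [← hd]
    linarith [Real.sqrt_pos.2 hk0]

theorem eq_of_monic_quadratic_of_irrational {ξ : ℝ} (hξ : Irrational ξ) {t u t' u' : ℤ}
    (h : ξ ^ 2 - t * ξ - u = 0) (h' : ξ ^ 2 - t' * ξ - u' = 0) : t = t' ∧ u = u' := by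
  have hlin : ((t - t' : ℤ) : ℝ) * ξ = (u' - u : ℤ) := by
    push_cast
    linear_combination h' - h
  have ht : t = t' := by
    by_contra hne
    exact (hξ.intCast_mul (sub_ne_zero.2 hne)).ne_int _ hlin
  subst ht
  refine ⟨rfl, ?_⟩
  have hu : (u : ℝ) = u' := by linear_combination h' - h
  exact_mod_cast hu

namespace IsLargerRoot

variable {ξ : ℝ} {t u : ℤ}

theorem two_mul_sub_eq (hξ : IsLargerRoot ξ t u) {s x : ℝ} (hs : 0 ≤ s)
    (hdisc : t ^ 2 + 4 * u = s ^ 2 * x) : 2 * ξ - t = s * √x := by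
  rw [← Real.sqrt_sq hs, ← Real.sqrt_mul (sq_nonneg s), ← hdisc, eq_comm,
    Real.sqrt_eq_iff_eq_sq _ (sub_nonneg.2 hξ.lt_two_mul.le)]
  · linear_combination -4 * hξ.root
  · nlinarith [hξ.root, sq_nonneg (2 * ξ - t)]

theorem irrational (hξ : IsLargerRoot ξ t u) {s D : ℤ} (hs : 0 < s) (hD : 0 ≤ D)
    (hsq : ¬ IsSquare D) (hdisc : t ^ 2 + 4 * u = s ^ 2 * D) : Irrational ξ := by
  have h : 2 * ξ - t = s * √(D : ℝ) :=
    hξ.two_mul_sub_eq (by exact_mod_cast hs.le) (by exact_mod_cast hdisc)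
  have hirr : Irrational (2 * ξ - t) :=
    h ▸ ((irrational_sqrt_intCast_iff_of_nonneg hD).2 hsq).intCast_mul hs.ne'
  exact (hirr.of_sub_intCast t).of_intCast_mul 2

theorem isPellian_iff (hξ : IsLargerRoot ξ t u) (hirr : Irrational ξ) (ht : 0 < t) {p q : ℤ} :
    IsPellian ξ p q ↔ ∃ ν, (ν = 1 ∨ ν = -1) ∧ IsPellSolution t u ν p q := by
  have hlt_iff (hq : 0 < q) : (t : ℝ) / 2 < (p : ℝ) / q ↔ t * q < 2 * p := by
    rw [div_lt_div_iff₀ two_pos (by exact_mod_cast hq), mul_comm (p : ℝ)]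
    exact_mod_cast Iff.rfl
  have htR : (0 : ℝ) < t := by exact_mod_cast ht
  constructor
  · rintro ⟨t', u', hroot, -, hq, hlt, hnorm⟩
    obtain ⟨rfl, rfl⟩ := eq_of_monic_quadratic_of_irrational hirr hξ.root hroot
    exact ⟨_, hnorm, hq, (hlt_iff hq).1 hlt, rfl⟩
  · rintro ⟨ν, hν, hq, hlt, rfl⟩
    have hconj : |(t : ℝ) - ξ| < ξ := abs_lt.2 ⟨by linarith, by linarith [hξ.lt_two_mul]⟩
    exact ⟨t, u, hξ.root, hconj, hq, (hlt_iff hq).2 hlt, hν⟩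

end IsLargerRoot

theorem IsPellSolution.isConvergent {ξ : ℝ} {t u p q : ℤ} (h : IsPellSolution t u (-1) p q)
    (hξ : IsLargerRoot ξ t u) (hdisc : 4 < t ^ 2 + 4 * u) : IsConvergent ξ p q := by
  obtain ⟨hq, hlt, hnorm⟩ := h
  have hq1 : (1 : ℝ) ≤ q := by exact_mod_cast hq
  have hltR : (t : ℝ) * q < 2 * p := by exact_mod_cast hlt
  have hnormR : (p : ℝ) ^ 2 - t * p * q - u * q ^ 2 = -1 := by exact_mod_cast hnorm
  -- `t - ξ` is the conjugate of `ξ`, so the norm equation is a product of two linear factors.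
  obtain ⟨y, hy⟩ : ∃ y, y = p - (t - ξ) * q := ⟨_, rfl⟩
  have hmul : (ξ * q - p) * y = 1 := by
    rw [hy]
    linear_combination (q : ℝ) ^ 2 * hξ.root - hnormR
  have hδ : 2 < 2 * ξ - t := by
    have hdiscR : (4 : ℝ) < t ^ 2 + 4 * u := by exact_mod_cast hdisc
    nlinarith [hξ.root, hξ.lt_two_mul]
  have hy_gt : 2 * (q : ℝ) - 1 < y := by
    by_contra! hle
    have : (2 * ξ - t) * q < 2 * y := by linarith
    have : ξ * q - p = (2 * ξ - t) * q - y := by rw [hy]; ring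
    nlinarith
  have hsub : ξ - p / q = (q * y)⁻¹ := by
    rw [mul_inv, ← eq_inv_of_mul_eq_one_left hmul]
    field_simp
  have hcop : IsCoprime p q := ⟨t * q - p, u * q, by linear_combination -hnorm⟩
  lift q to ℕ using hq.le
  have hy0 : 0 < y := by linarith
  refine Real.exists_rat_eq_convergent' ⟨hcop, fun h1 => ?_, ?_⟩
  · have hpos : 0 < ξ - p / (q : ℤ) := hsub ▸ by positivity
    rw [h1, Int.cast_one, div_one] at hpos
    linarith
  · rw [hsub, abs_of_pos (by positivity)]
    gcongr
    nlinarith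

theorem not_isSquare_of_even_sub {a D : ℤ} (ha : 0 ≤ a) (hlt : a ^ 2 < D) (hgt : D < (a + 2) ^ 2)
    (heven : Even (D - a)) : ¬ IsSquare D := by
  rintro ⟨w, rfl⟩
  rw [← sq] at hlt hgt heven
  have hw : |w| = a + 1 := by
    have h1 : |w| < a + 2 := abs_lt_of_sq_lt_sq hgt (by linarith)
    have h2 : a < |w| := abs_of_nonneg ha ▸ sq_lt_sq.1 hlt
    omega
  rw [← sq_abs, hw, show (a + 1) ^ 2 - a = a * (a + 1) + 1 by ring] at heven
  exact Int.not_even_iff_odd.2 (Int.even_mul_succ_self a).add_one heven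

theorem not_isSquare_disc {v m ε : ℤ} (hv : 0 < v) (hm : 0 < m) (hε : ε = 1 ∨ ε = -1)
    (hD : 0 < v * m ^ 2 + 4 * ε) : ¬ IsSquare (v * (v * m ^ 2 + 4 * ε)) := by
  have hvm : 0 < v * m := mul_pos hv hm
  obtain ⟨c, hc⟩ : Even (v * m * (v * m - 1)) := Int.even_mul_pred_self _
  rcases hε with rfl | rfl
  · exact not_isSquare_of_even_sub hvm.le (by linarith) (by nlinarith)
      ⟨c + 2 * v, by linear_combination hc⟩
  rcases lt_or_ge 1 (v * (m - 1)) with hlarge | hsmall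
  · exact not_isSquare_of_even_sub (a := v * m - 2) (by nlinarith) (by nlinarith) (by nlinarith)
      ⟨c + 1 - 2 * v, by linear_combination hc⟩
  obtain rfl : m = 1 := by
    by_contra hne
    have hm2 : 2 ≤ m := by omega
    obtain rfl : v = 1 := by nlinarith
    obtain rfl : m = 2 := by linarith
    norm_num at hD
  have : 4 < v := by linarith
  exact not_isSquare_of_even_sub (a := v - 4) (by linarith) (by nlinarith) (by nlinarith)
    ⟨c + 2 - 2 * v, by linear_combination hc⟩

/-! ### Exceptional numbers -/

theorem IsExceptional.exists_isPellSolution {ξ : ℝ} {t u : ℤ} (h : IsExceptional ξ)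
    (hirr : Irrational ξ) (hroot : ξ ^ 2 - t * ξ - u = 0) :
    u < 0 ∧ 4 < t ^ 2 + 4 * u ∧ ∃ p q, IsPellSolution t u (-1) p q := by
  have h5 : √5 ^ 2 = 5 := Real.sq_sqrt (by norm_num)
  have h2 : √2 ^ 2 = 2 := Real.sq_sqrt (by norm_num)
  have hr_sq {c r n : ℕ} {U : ℕ → ℕ} (hU : IsLucasSeq c U) (hr : r ∣ U (2 * n + 1)) :
      (0 : ℤ) < r ^ 2 := by
    have := Nat.pos_of_dvd_of_pos hr (hU.odd_index_pos n)
    positivity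
  rcases h with ⟨r, n, hr, rfl | rfl⟩ | ⟨r, n, hr, rfl⟩
  · obtain ⟨rfl, rfl⟩ := eq_of_monic_quadratic_of_irrational hirr hroot (t' := r * (2 * 2 - 1))
      (u' := r ^ 2 * (1 + 2 * 1 - 2 ^ 2)) (by push_cast; linear_combination (r : ℝ) ^ 2 / 4 * h5)
    have := hr_sq isLucasSeq_fib hr
    exact ⟨by linarith, by linarith, isLucasSeq_fib.exists_isPellSolution_of_dvd one_pos 2 hr⟩
  · obtain ⟨rfl, rfl⟩ := eq_of_monic_quadratic_of_irrational hirr hroot (t' := r * (2 * 3 - 1))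
      (u' := r ^ 2 * (1 + 3 * 1 - 3 ^ 2)) (by push_cast; linear_combination (r : ℝ) ^ 2 / 4 * h5)
    have := hr_sq isLucasSeq_fib hr
    exact ⟨by linarith, by linarith, isLucasSeq_fib.exists_isPellSolution_of_dvd one_pos 3 hr⟩
  · obtain ⟨rfl, rfl⟩ := eq_of_monic_quadratic_of_irrational hirr hroot (t' := r * (2 * 3 - 2))
      (u' := r ^ 2 * (1 + 3 * 2 - 3 ^ 2)) (by push_cast; linear_combination (r : ℝ) ^ 2 * h2)
    have := hr_sq isLucasSeq_pellNumber hr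
    exact ⟨by linarith, by linarith,
      isLucasSeq_pellNumber.exists_isPellSolution_of_dvd two_pos 3 hr⟩

theorem IsPellSolution.isExceptional {ξ : ℝ} {s v m : ℕ} {p q : ℤ} (hs : 0 < s) (hv : 0 < v)
    (h : IsPellSolution (s * (v * m)) (s ^ 2 * (-1 * v)) (-1) p q)
    (hξ : IsLargerRoot ξ (s * (v * m)) (s ^ 2 * (-1 * v))) : IsExceptional ξ := by
  have hvZ : (0 : ℤ) < v := by exact_mod_cast hv
  rw [isPellSolution_mul_iff (by exact_mod_cast hs)] at h
  have hequation : p ^ 2 + v * (s * q) ^ 2 + 1 = v * m * p * (s * q) := by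
    linear_combination h.norm_eq
  rcases eq_of_vieta_equation hvZ (h.num_pos (by positivity)) h.den_pos hequation with
    ⟨h1, h2⟩ | ⟨h1, h2⟩ | ⟨h1, h2⟩
  all_goals
    obtain rfl : v = _ := Int.natCast_inj.1 h1
    obtain rfl : m = _ := Int.natCast_inj.1 h2
  · obtain ⟨n, hn⟩ := isLucasSeq_fib.exists_dvd_of_isPellSolution one_pos (j := 2) h
    have hroot := hξ.two_mul_sub_eq (s := s) (x := 5) s.cast_nonneg (by push_cast; ring)
    push_cast at hroot
    exact Or.inl ⟨s, n, hn, Or.inl (by linear_combination hroot / 2)⟩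
  · obtain ⟨n, hn⟩ := isLucasSeq_pellNumber.exists_dvd_of_isPellSolution two_pos (j := 3) h
    have hroot := hξ.two_mul_sub_eq (s := 2 * s) (x := 2) (by positivity) (by push_cast; ring)
    push_cast at hroot
    exact Or.inr ⟨s, n, hn, by linear_combination hroot / 2⟩
  · obtain ⟨n, hn⟩ := isLucasSeq_fib.exists_dvd_of_isPellSolution one_pos (j := 3) h
    have hroot := hξ.two_mul_sub_eq (s := s) (x := 5) s.cast_nonneg (by push_cast; ring)
    push_cast at hroot
    exact Or.inl ⟨s, n, hn, Or.inr (by linear_combination hroot / 2)⟩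

/-! ### Pellian fractions and the orbit of `∞` -/

theorem IsPellian.mem_orbitInfty {ξ d k : ℝ} {s v m : ℕ} {ε p q : ℤ} (hs : 0 < s) (hv : 0 < v)
    (hm : 0 < m) (hε : ε = 1 ∨ ε = -1) (hξ : IsLargerRoot ξ (s * (v * m)) (s ^ 2 * (ε * v)))
    (hirr : Irrational ξ) (hne : ¬ IsExceptional ξ) (hd : 2 * d = s * (v * m))
    (hk : k - d ^ 2 = s ^ 2 * (ε * v)) (h : IsPellian ξ p q) :
    ((p / q : ℝ) : OnePoint ℝ) ∈ orbitInfty (lftXi d k) := by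
  obtain ⟨ν, hν, hsol⟩ := (hξ.isPellian_iff hirr (by positivity)).1 h
  have hεν : ε = 1 ∨ ν = 1 := by
    by_contra! hneg
    obtain rfl := hε.resolve_left hneg.1
    obtain rfl := hν.resolve_left hneg.2
    exact hne (hsol.isExceptional hs hv hξ)
  have hs0 : (s : ℝ) ≠ 0 := by exact_mod_cast hs.ne'
  have hmem := ((isPellSolution_mul_iff (by exact_mod_cast hs)).1 hsol).mem_orbitInfty hs0
    (by exact_mod_cast hv) (by exact_mod_cast hm) hε hν hεν hd hk
  rwa [Int.cast_mul, Int.cast_natCast, mul_div_mul_left _ _ hs0] at hmem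

theorem IsExceptional.exists_isPellian_notMem_orbitInfty {ξ d k : ℝ} {t u : ℤ}
    (h : IsExceptional ξ) (hξ : IsLargerRoot ξ t u) (hirr : Irrational ξ) (ht : 0 < t)
    (hd : 2 * d = t) (hk : k - d ^ 2 = u) :
    ∃ p q : ℤ, IsPellian ξ p q ∧ IsConvergent ξ p q ∧
      ((p / q : ℝ) : OnePoint ℝ) ∉ orbitInfty (lftXi d k) := by
  obtain ⟨hu, hdisc, p, q, hsol⟩ := h.exists_isPellSolution hirr hξ.root
  exact ⟨p, q, (hξ.isPellian_iff hirr ht).2 ⟨-1, Or.inr rfl, hsol⟩, hsol.isConvergent hξ hdisc,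
    hsol.notMem_orbitInfty (by norm_num) hu hd hk⟩

theorem theorem6p5 (s v m : ℕ) (hs : 0 < s) (hv : 0 < v) (hm : 0 < m)
    (ε : ℤ) (hε : ε = 1 ∨ ε = -1)
    (hirr : ε = -1 → 4 < v * m ^ 2)
    (d k : ℚ) (hd : d = (s * v * m : ℚ) / 2)
    (hk : k = (s ^ 2 * v * (v * m ^ 2 + 4 * ε) : ℚ) / 4)
    (ξ : ℝ) (hξ : ξ = (d : ℝ) + √(k : ℝ)) :
    (¬ IsExceptional ξ → ∀ p q : ℤ, IsPellian ξ p q →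
      (((p : ℝ) / q : ℝ) : OnePoint ℝ) ∈ orbitInfty (lftXi d k)) ∧
    (IsExceptional ξ → ∃ p q : ℤ, IsPellian ξ p q ∧ IsConvergent ξ p q ∧
      (((p : ℝ) / q : ℝ) : OnePoint ℝ) ∉ orbitInfty (lftXi d k)) := by
  have hvZ : (0 : ℤ) < v := by exact_mod_cast hv
  have hD : 0 < (v * m ^ 2 + 4 * ε : ℤ) := by
    rcases hε with rfl | rfl
    · positivity
    · have : (4 : ℤ) < v * m ^ 2 := by exact_mod_cast hirr rfl
      linarith
  have htrace : 2 * (d : ℝ) = s * (v * m) := by rw [hd]; push_cast; ring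
  have hnorm : (k : ℝ) - d ^ 2 = s ^ 2 * (ε * v) := by rw [hk, hd]; push_cast; ring
  have hk0 : (0 : ℝ) < k := by
    have : (0 : ℚ) < v * m ^ 2 + 4 * ε := by exact_mod_cast hD
    rw [hk]
    exact_mod_cast (by positivity : (0 : ℚ) < s ^ 2 * v * (v * m ^ 2 + 4 * ε) / 4)
  have hroot : IsLargerRoot ξ (s * (v * m)) (s ^ 2 * (ε * v)) :=
    hξ ▸ isLargerRoot_add_sqrt hk0 (by exact_mod_cast htrace) (by exact_mod_cast hnorm)
  have hirrat : Irrational ξ := hroot.irrational (s := s) (by exact_mod_cast hs)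
    (mul_pos hvZ hD).le (not_isSquare_disc hvZ (by exact_mod_cast hm) hε hD) (by ring)
  exact ⟨fun hne _ _ h => h.mem_orbitInfty hs hv hm hε hroot hirrat hne htrace hnorm,
    fun hexc => hexc.exists_isPellian_notMem_orbitInfty hroot hirrat (by positivity)
      (by exact_mod_cast htrace) (by exact_mod_cast hnorm)⟩
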